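/- Let $p>1$, $\alpha_0>-1$ and $\theta>-1$. For real $q\ge 1$ and $\alpha$, let $L^q_\alpha$ be the space of measurable $u:(0,\infty)\to\mathbb R$ with $\|u\|_{L^q_\alpha}=\left(\int_0^\infty |u(r)|^q r^{\alpha}\,dr\right)^{1/q}<\infty$. Let $X^{1,p}_\infty=X^{1,p}_\infty(\alpha_0,p-1)$ be the weighted Sobolev space of all $u\in L^p_{\alpha_0}$ that have a weak derivative $u'$ on $(0,\infty)$ with $u'\in L^p_{p-1}$, with the norm $$\|u\|_{X^{1,p}_\infty}=\left(\|u\|_{L^p_{\alpha_0}}^p+\|u'\|_{L^p_{p-1}}^p\right)^{1/p}.$$ For $t\ge 0$ put $\exp_p(t)=\sum_{j=0}^\infty \dfrac{t^{p-1+j}}{\Gamma(p+j)}$, and for $\mu\ge 0$ put $$d_{p,\mu,\theta}=\sup_{u\in X^{1,p}_\infty,\ \|u\|_{X^{1,p}_\infty}=1}\ \int_0^\infty \exp_p\!\left(\mu|u|^{\frac p{p-1}}\right)r^\theta\,dr\in[0,\infty].$$ (a) If $\theta\le\alpha_0$, then $\exp_p\!\left(\mu|u|^{\frac{p}{p-1}}\right)\in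 L^1_\theta$ for all $\mu\ge 0$ and all $u\in X^{1,p}_\infty$. (b) If $\theta\le\alpha_0$ and $0\le\mu<\theta+1$, then $d_{p,\mu,\theta}<\infty$. (c) If $\mu>\theta+1$, then $d_{p,\mu,\theta}=\infty$. -/

import Mathlib

open MeasureTheory Set
open scoped ENNReal ContDiff

noncomputable section

/-- Membership in the weighted Lebesgue space `L^p_α = L^p_α(0, ∞)`: Lebesgue measurability on
`(0, ∞)` together with `∫₀^∞ |u|^p r^α dr < ∞`. Only the values of `u` on `(0, ∞)` matter. -/
def MemWeightedLp (p α : ℝ) (u : ℝ → ℝ) : Prop :=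
  AEStronglyMeasurable u (volume.restrict (Ioi 0)) ∧
    IntegrableOn (fun r => |u r| ^ p * r ^ α) (Ioi 0)

/-- The norm `(∫₀^∞ |u|^p r^α dr)^{1/p}` of `L^p_α(0, ∞)`. -/
def weightedLpNorm (p α : ℝ) (u : ℝ → ℝ) : ℝ :=
  (∫ r in Ioi (0 : ℝ), |u r| ^ p * r ^ α) ^ (1 / p)

/-- `v` is a weak derivative of `u` on the open interval `(0, ∞)`. -/
def IsWeakDeriv (u v : ℝ → ℝ) : Prop :=
  LocallyIntegrableOn u (Ioi 0) ∧ LocallyIntegrableOn v (Ioi 0) ∧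
    ∀ φ : ℝ → ℝ, ContDiff ℝ ∞ φ → HasCompactSupport φ → tsupport φ ⊆ Ioi 0 →
      ∫ r in Ioi (0 : ℝ), u r * deriv φ r = -∫ r in Ioi (0 : ℝ), v r * φ r

/-- Weak derivatives are unique up to equality almost everywhere on `(0, ∞)`. -/
theorem IsWeakDeriv.ae_eq {u v w : ℝ → ℝ} (hv : IsWeakDeriv u v) (hw : IsWeakDeriv u w) :
    v =ᵐ[volume.restrict (Ioi 0)] w := by
  have key : ∀ᵐ x ∂(volume : Measure ℝ), x ∈ Ioi (0 : ℝ) → (v - w) x = 0 := by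
    refine isOpen_Ioi.ae_eq_zero_of_integral_contDiff_smul_eq_zero (hv.2.1.sub hw.2.1) ?_
    intro φ hφ hc hs
    have hi : ∀ f : ℝ → ℝ, LocallyIntegrableOn f (Ioi 0) →
        IntegrableOn (fun r => f r * φ r) (Ioi 0) := by
      intro f hf
      have h1 : IntegrableOn f (tsupport φ) := hf.integrableOn_compact_subset hs hc
      have h2 : IntegrableOn (fun r => f r * φ r) (tsupport φ) :=
        h1.mul_continuousOn hφ.continuous.continuousOn hc
      have h3 : Integrable (fun r => f r * φ r) :=
        (integrableOn_iff_integrable_of_support_subset (fun r hr => by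
          apply subset_tsupport φ
          intro h0
          exact hr (by simp [h0]))).1 h2
      exact h3.integrableOn
    have e : ∀ r, φ r • (v - w) r = v r * φ r - w r * φ r := by
      intro r; simp only [smul_eq_mul, Pi.sub_apply]; ring
    have hr : ∫ r, φ r • (v - w) r = ∫ r in Ioi (0 : ℝ), φ r • (v - w) r := by
      symm
      apply setIntegral_eq_integral_of_forall_compl_eq_zero
      intro r hr
      have : φ r = 0 := image_eq_zero_of_notMem_tsupport (fun h => hr (hs h))
      simp [this]
    rw [hr]
    simp only [e]
    rw [integral_sub (hi v hv.2.1) (hi w hw.2.1)]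
    have a := hv.2.2 φ hφ hc hs
    have b := hw.2.2 φ hφ hc hs
    linarith
  rw [Filter.EventuallyEq, ae_restrict_iff' measurableSet_Ioi]
  filter_upwards [key] with x hx h
  exact sub_eq_zero.1 (hx h)

open Classical in
/-- The weak derivative of `u` on `(0, ∞)` (some representative; zero if there is none). -/
def weakDeriv (u : ℝ → ℝ) : ℝ → ℝ :=
  if h : ∃ v, IsWeakDeriv u v then h.choose else 0

/-- The weighted Sobolev space `X^{1,p}_∞(α₀, α₁)`: functions `u` on `(0, ∞)` with
`u ∈ L^p_{α₀}` that have a weak derivative belonging to `L^p_{α₁}`. -/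
def weightedSobolev (p α₀ α₁ : ℝ) : Set (ℝ → ℝ) :=
  {u | MemWeightedLp p α₀ u ∧ ∃ v, IsWeakDeriv u v ∧ MemWeightedLp p α₁ v}

/-- The norm `(‖u‖_{L^p_{α₀}}^p + ‖u'‖_{L^p_{α₁}}^p)^{1/p}` of `X^{1,p}_∞(α₀, α₁)`. -/
def weightedSobolevNorm (p α₀ α₁ : ℝ) (u : ℝ → ℝ) : ℝ :=
  (weightedLpNorm p α₀ u ^ p + weightedLpNorm p α₁ (weakDeriv u) ^ p) ^ (1 / p)

/-- `exp_p(t) = ∑_{j ≥ 0} t^{p-1+j} / Γ(p+j)`. -/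
def expP (p t : ℝ) : ℝ :=
  ∑' j : ℕ, t ^ (p - 1 + (j : ℝ)) / Real.Gamma (p + j)

/-- `d_{p,μ,θ}`, the supremum of `∫₀^∞ exp_p(μ |u|^{p/(p-1)}) r^θ dr` over the unit sphere of
`X^{1,p}_∞(α₀, p-1)`, as an element of `[0, ∞]`. -/
def trudingerMoserSup (p α₀ μ θ : ℝ) : ℝ≥0∞ :=
  ⨆ u ∈ {u : ℝ → ℝ | u ∈ weightedSobolev p α₀ (p - 1) ∧ weightedSobolevNorm p α₀ (p - 1) u = 1},
    ∫⁻ r in Ioi (0 : ℝ), ENNReal.ofReal (expP p (μ * |u r| ^ (p / (p - 1))) * r ^ θ)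

/-- The series defining `exp_p(t)` converges for `t ≥ 0` and `p > 1`. -/
theorem summable_expP {p t : ℝ} (hp : 1 < p) (ht : 0 ≤ t) :
    Summable fun j : ℕ => t ^ (p - 1 + (j : ℝ)) / Real.Gamma (p + j) := by
  have hG : ∀ j : ℕ, (j.factorial : ℝ) * Real.Gamma p ≤ Real.Gamma (p + j) := by
    intro j
    induction j with
    | zero => simp
    | succ n ih =>
      have h0 : (0 : ℝ) ≤ n := Nat.cast_nonneg n
      have hpos : 0 < Real.Gamma (p + n) := Real.Gamma_pos_of_pos (by linarith)
      have h1 : Real.Gamma (p + (n + 1 : ℕ)) = (p + n) * Real.Gamma (p + n) := by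
        rw [← Real.Gamma_add_one (by linarith)]; push_cast; ring_nf
      rw [h1, Nat.factorial_succ]
      push_cast
      nlinarith
  have hgp : 0 < Real.Gamma p := Real.Gamma_pos_of_pos (by linarith)
  have hs : Summable fun j : ℕ => t ^ (p - 1) / Real.Gamma p * (t ^ j / (j.factorial : ℝ)) :=
    (Real.summable_pow_div_factorial t).mul_left _
  refine Summable.of_nonneg_of_le (fun j => ?_) (fun j => ?_) hs
  · have : 0 < Real.Gamma (p + j) := Real.Gamma_pos_of_pos (by positivity)
    positivity
  · have hf : (0 : ℝ) < j.factorial := by exact_mod_cast j.factorial_pos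
    rw [Real.rpow_add_of_nonneg ht (by linarith) (Nat.cast_nonneg j), Real.rpow_natCast]
    calc t ^ (p - 1) * t ^ j / Real.Gamma (p + j)
        ≤ t ^ (p - 1) * t ^ j / ((j.factorial : ℝ) * Real.Gamma p) := by
          gcongr
          exact hG j
      _ = _ := by field_simp

end

/-!
The function `exp_p` grows like the exponential function: `exp_p t ≤ t ^ (p - 1) eᵗ / Γ(p)`
(`expP_le`), and `exp_p t` outgrows `e ^ (κ t)` for every `κ < 1` (`tendsto_expP_mul_exp_neg`).
The constant `θ + 1` arises by comparing this growth with the logarithmic singularity allowed at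
the origin.

For the upper bounds, `u` is almost everywhere a primitive of its weak derivative `v`
(`IsWeakDeriv.exists_ae_eq_primitive`). Since `r ^ (p - 1)` and `1 / r` are conjugate weights,
Hölder's inequality gives `|u s - u r| ≤ b ^ (1 / p) log (s / r) ^ ((p - 1) / p)`, where `b` is the
energy `∫ |v| ^ p r ^ (p - 1)` over `(r, s)` (`abs_intervalIntegral_le_log`). This has two
consequences.

* On `[R, ∞)` the function `u` is bounded by a constant depending only on its norm
  (`exists_abs_le_of_weighted_bounds`). There `exp_p (μ |u| ^ (p / (p - 1)))` is at most a multiple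
  of `|u| ^ p`, and `r ^ θ` is at most a multiple of `r ^ α₀` because `θ ≤ α₀`.
* On `(0, R]` the quantity `|u r| ^ (p / (p - 1))` is at most `b ^ (1 / (p - 1)) log (R / r)` up to
  lower order terms, so the integrand is at most a multiple of `r ^ (θ - κ)` for any
  `κ > μ b ^ (1 / (p - 1))`. It is integrable if `κ < θ + 1`.

Both estimates are uniform (`exists_lintegral_expP_le`). On the unit sphere one takes `b = 1`, which
requires `μ < θ + 1`. For a single function and arbitrary `μ` one takes `R` so small that the
energy `b` of `u` on `(0, R]` satisfies `μ b ^ (1 / (p - 1)) < θ + 1`.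

For the divergence, the Moser functions `min L (log (1 / r))`, cut off at `r = 1`, have energy
exactly `L` and bounded `L^p_{α₀}` norm, so that after normalisation `|u| ^ (p / (p - 1))` is
`(1 + o(1)) L` on `(0, e⁻ᴸ]`. The integral over this interval alone is of the order of
`exp_p (μ (1 + o(1)) L) e ^ (-(θ + 1) L)`, which tends to infinity if `μ > θ + 1`.
-/

/-! ### Growth of `exp_p` -/

theorem Gamma_add_natCast_lower {p : ℝ} (hp : 1 < p) (j : ℕ) :
    (j.factorial : ℝ) * Real.Gamma p ≤ Real.Gamma (p + j) := by
  induction j with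
  | zero => simp
  | succ n ih =>
    have h0 : (0 : ℝ) ≤ n := Nat.cast_nonneg n
    have hpos : 0 < Real.Gamma (p + n) := Real.Gamma_pos_of_pos (by linarith)
    have h1 : Real.Gamma (p + (n + 1 : ℕ)) = (p + n) * Real.Gamma (p + n) := by
      rw [← Real.Gamma_add_one (by linarith)]; push_cast; ring_nf
    rw [h1, Nat.factorial_succ]
    push_cast
    nlinarith

theorem Gamma_add_natCast_upper {p : ℝ} (hp : 1 < p) (j : ℕ) :
    Real.Gamma (p + j) ≤ Real.Gamma p * ((⌈p⌉₊ + j).factorial : ℝ) := by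
  have hgp : 0 < Real.Gamma p := Real.Gamma_pos_of_pos (by linarith)
  induction j with
  | zero =>
    have : (1 : ℝ) ≤ ((⌈p⌉₊ + 0).factorial : ℝ) := by exact_mod_cast Nat.factorial_pos _
    simpa using le_mul_of_one_le_right hgp.le this
  | succ n ih =>
    have h0 : (0 : ℝ) ≤ n := Nat.cast_nonneg n
    have h1 : Real.Gamma (p + (n + 1 : ℕ)) = (p + n) * Real.Gamma (p + n) := by
      rw [← Real.Gamma_add_one (by linarith)]; push_cast; ring_nf
    have hc := Nat.le_ceil p
    rw [h1, ← Nat.add_assoc, Nat.factorial_succ]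
    push_cast
    calc (p + n) * Real.Gamma (p + n)
        ≤ ((⌈p⌉₊ : ℝ) + n + 1) * (Real.Gamma p * ((⌈p⌉₊ + n).factorial : ℝ)) := by
          apply mul_le_mul (by linarith) ih (Real.Gamma_pos_of_pos (by linarith)).le
          linarith
      _ = _ := by ring

theorem expP_nonneg {p t : ℝ} (hp : 1 < p) (ht : 0 ≤ t) : 0 ≤ expP p t := by
  refine tsum_nonneg fun j => ?_
  have : 0 < Real.Gamma (p + j) := Real.Gamma_pos_of_pos (by positivity)
  positivity

theorem expP_le_expP {p s t : ℝ} (hp : 1 < p) (hs : 0 ≤ s) (hst : s ≤ t) :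
    expP p s ≤ expP p t := by
  refine (summable_expP hp hs).tsum_le_tsum (fun j => ?_) (summable_expP hp (hs.trans hst))
  have : 0 < Real.Gamma (p + j) := Real.Gamma_pos_of_pos (by positivity)
  have h0 : (0 : ℝ) ≤ j := Nat.cast_nonneg j
  have : 0 ≤ p - 1 + (j : ℝ) := by linarith
  gcongr

theorem expP_le {p t : ℝ} (hp : 1 < p) (ht : 0 ≤ t) :
    expP p t ≤ t ^ (p - 1) * Real.exp t / Real.Gamma p := by
  have hgp : 0 < Real.Gamma p := Real.Gamma_pos_of_pos (by linarith)
  have hs : HasSum (fun j : ℕ => t ^ (p - 1) / Real.Gamma p * (t ^ j / (j.factorial : ℝ)))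
      (t ^ (p - 1) / Real.Gamma p * Real.exp t) := by
    rw [Real.exp_eq_exp_ℝ]
    exact (NormedSpace.expSeries_div_hasSum_exp t).mul_left _
  have e : t ^ (p - 1) * Real.exp t / Real.Gamma p = t ^ (p - 1) / Real.Gamma p * Real.exp t := by
    ring
  rw [e, ← hs.tsum_eq]
  refine (summable_expP hp ht).tsum_le_tsum (fun j => ?_) hs.summable
  have hf : (0 : ℝ) < j.factorial := by exact_mod_cast j.factorial_pos
  rw [Real.rpow_add_of_nonneg ht (by linarith) (Nat.cast_nonneg j), Real.rpow_natCast]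
  calc t ^ (p - 1) * t ^ j / Real.Gamma (p + j)
      ≤ t ^ (p - 1) * t ^ j / ((j.factorial : ℝ) * Real.Gamma p) := by
        gcongr
        exact Gamma_add_natCast_lower hp j
    _ = _ := by field_simp

/-- Multiplication by `t ^ ⌈p⌉₊` turns the series of `exp_p` into one that dominates, up to the factor
`Γ(p)`, the exponential series without its first `⌈p⌉₊` terms. -/
theorem le_expP {p t : ℝ} (hp : 1 < p) (ht : 1 ≤ t) :
    Real.exp t - ⌈p⌉₊ * t ^ ⌈p⌉₊ ≤ Real.Gamma p * t ^ ⌈p⌉₊ * expP p t := by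
  have hgp : 0 < Real.Gamma p := Real.Gamma_pos_of_pos (by linarith)
  have ht0 : 0 < t := by linarith
  set n := ⌈p⌉₊
  have hs : HasSum (fun j : ℕ => t ^ j / (j.factorial : ℝ)) (Real.exp t) := by
    rw [Real.exp_eq_exp_ℝ]; exact NormedSpace.expSeries_div_hasSum_exp t
  have h1 := hs.summable.sum_add_tsum_nat_add n
  rw [hs.tsum_eq] at h1
  have h2 : ∑ i ∈ Finset.range n, t ^ i / (i.factorial : ℝ) ≤ n * t ^ n := by
    calc ∑ i ∈ Finset.range n, t ^ i / (i.factorial : ℝ) ≤ ∑ i ∈ Finset.range n, t ^ n := by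
          refine Finset.sum_le_sum fun i hi => ?_
          have : (1 : ℝ) ≤ i.factorial := by exact_mod_cast i.factorial_pos
          exact (div_le_self (by positivity) this).trans
            (pow_le_pow_right₀ ht (Finset.mem_range.1 hi).le)
      _ = _ := by simp
  have h3 : ∑' j : ℕ, t ^ (j + n) / ((j + n).factorial : ℝ)
      ≤ Real.Gamma p * t ^ n * expP p t := by
    rw [expP, ← tsum_mul_left]
    refine ((summable_nat_add_iff n).2 hs.summable).tsum_le_tsum (fun j => ?_)
      ((summable_expP hp ht0.le).mul_left _)
    have hG : 0 < Real.Gamma (p + j) := Real.Gamma_pos_of_pos (by positivity)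
    have hf : (0 : ℝ) < ((j + n).factorial : ℝ) := by exact_mod_cast Nat.factorial_pos _
    have hu := Gamma_add_natCast_upper hp j
    rw [Nat.add_comm] at hu
    have hpow : t ^ j ≤ t ^ (p - 1 + (j : ℝ)) := by
      rw [← Real.rpow_natCast]
      exact Real.rpow_le_rpow_of_exponent_le ht (by linarith)
    rw [mul_div_assoc', div_le_div_iff₀ hf hG, pow_add]
    calc t ^ j * t ^ n * Real.Gamma (p + j)
        ≤ t ^ (p - 1 + (j : ℝ)) * t ^ n * (Real.Gamma p * ((j + n).factorial : ℝ)) := by gcongr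
      _ = _ := by ring
  linarith

theorem tendsto_expP_mul_exp_neg {p κ : ℝ} (hp : 1 < p) (hκ0 : 0 < κ) (hκ : κ < 1) :
    Filter.Tendsto (fun t => expP p t * Real.exp (-(κ * t))) Filter.atTop Filter.atTop := by
  have hgp : 0 < Real.Gamma p := Real.Gamma_pos_of_pos (by linarith)
  set n := ⌈p⌉₊ with hn
  have h1 := tendsto_exp_mul_div_rpow_atTop (n : ℝ) (1 - κ) (by linarith)
  have h2 : Filter.Tendsto
      (fun t : ℝ => (Real.exp ((1 - κ) * t) / t ^ (n : ℝ) - n) / Real.Gamma p)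
      Filter.atTop Filter.atTop :=
    (Filter.tendsto_atTop_add_const_right _ (-(n : ℝ)) h1).atTop_div_const hgp
  refine Filter.tendsto_atTop_mono' _ ?_ h2
  filter_upwards [Filter.eventually_ge_atTop 1] with t ht
  have ht0 : 0 < t := by linarith
  have hl := le_expP hp ht
  rw [← hn] at hl
  have htn : 0 < t ^ n := by positivity
  have he : Real.exp (-(κ * t)) ≤ 1 := by
    rw [Real.exp_le_one_iff]; have := mul_pos hκ0 ht0; linarith
  have hee : Real.exp ((1 - κ) * t) = Real.exp t * Real.exp (-(κ * t)) := by
    rw [← Real.exp_add]; ring_nf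
  rw [Real.rpow_natCast, div_le_iff₀ hgp, sub_le_iff_le_add, div_le_iff₀ htn, hee]
  have h0 : 0 < Real.exp (-(κ * t)) := Real.exp_pos _
  have h4 := mul_le_mul_of_nonneg_right hl h0.le
  have h5 : (n : ℝ) * t ^ n * Real.exp (-(κ * t)) ≤ n * t ^ n :=
    mul_le_of_le_one_right (by positivity) he
  nlinarith

/-- The truncation at `0` makes `exp_p` monotone on the whole line, hence measurable. -/
theorem measurable_expP_max {p : ℝ} (hp : 1 < p) : Measurable fun t => expP p (max t 0) := by
  refine Monotone.measurable fun s t hst => ?_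
  exact expP_le_expP hp (le_max_right _ _) (max_le_max_right _ hst)

/-! ### Weak derivatives and primitives -/

theorem intervalIntegrable_of_locallyIntegrableOn_Ioi {v : ℝ → ℝ}
    (hv : LocallyIntegrableOn v (Ioi 0)) {a b : ℝ} (ha : 0 < a) (hb : 0 < b) :
    IntervalIntegrable v volume a b := by
  rw [intervalIntegrable_iff']
  refine hv.integrableOn_compact_subset (fun x hx => ?_) isCompact_uIcc
  exact (lt_min ha hb).trans_le hx.1

theorem exists_subset_Ioo_of_isCompact_subset_Ioi {K : Set ℝ} (hK : IsCompact K)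
    (hs : K ⊆ Ioi 0) : ∃ a b : ℝ, 0 < a ∧ a < 1 ∧ 1 < b ∧ K ⊆ Ioo a b := by
  have hc : IsCompact (insert 1 K) := hK.insert 1
  obtain ⟨m, hm⟩ := hc.exists_isLeast ⟨1, mem_insert _ _⟩
  obtain ⟨M, hM⟩ := hc.exists_isGreatest ⟨1, mem_insert _ _⟩
  have hm0 : 0 < m := by
    rcases hm.1 with h | h
    · rw [h]; norm_num
    · exact hs h
  have hm1 := hm.2 (mem_insert _ _)
  have hM1 := hM.2 (mem_insert _ _)
  refine ⟨m / 2, M + 1, by linarith, by linarith, by linarith, fun x hx => ⟨?_, ?_⟩⟩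
  · have := hm.2 (mem_insert_of_mem _ hx); linarith
  · have := hM.2 (mem_insert_of_mem _ hx); linarith

theorem setIntegral_Ioi_eq_intervalIntegral {f : ℝ → ℝ} {a b : ℝ} (ha : 0 < a) (hab : a ≤ b)
    (hf : ∀ x, x ∉ Ioo a b → f x = 0) : ∫ r in Ioi (0 : ℝ), f r = ∫ r in a..b, f r := by
  rw [intervalIntegral.integral_of_le hab]
  refine (setIntegral_eq_of_subset_of_forall_sdiff_eq_zero measurableSet_Ioi
    (fun x hx => ha.trans hx.1) fun x hx => hf x fun h => hx.2 ⟨h.1, h.2.le⟩)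

theorem continuousOn_primitive_Ioi {v : ℝ → ℝ} (hv : LocallyIntegrableOn v (Ioi 0)) :
    ContinuousOn (fun r => ∫ t in (1 : ℝ)..r, v t) (Ioi 0) := by
  intro r hr
  have hr0 : (0 : ℝ) < r := hr
  have hi : IntervalIntegrable v volume (min 1 (r / 2)) (max 1 (r + 1)) :=
    intervalIntegrable_of_locallyIntegrableOn_Ioi hv (by positivity) (by positivity)
  have h := intervalIntegral.continuousOn_primitive_interval' hi (a := 1)
    (by rw [uIcc_of_le (by simp)]; exact ⟨min_le_left _ _, le_max_left _ _⟩)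
  refine (h.continuousAt ?_).continuousWithinAt
  rw [uIcc_of_le (by simp)]
  refine Icc_mem_nhds ?_ ?_
  · exact (min_le_right _ _).trans_lt (by linarith)
  · exact lt_of_lt_of_le (by linarith) (le_max_right _ _)

theorem isWeakDeriv_primitive {v : ℝ → ℝ} (hv : LocallyIntegrableOn v (Ioi 0)) :
    IsWeakDeriv (fun r => ∫ t in (1 : ℝ)..r, v t) v := by
  refine ⟨(continuousOn_primitive_Ioi hv).locallyIntegrableOn measurableSet_Ioi, hv, ?_⟩
  intro φ hφ hc hs
  obtain ⟨a, b, ha, ha1, hb1, hsub⟩ := exists_subset_Ioo_of_isCompact_subset_Ioi hc hs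
  have hφ0 : ∀ x, x ∉ Ioo a b → φ x = 0 := fun x hx =>
    image_eq_zero_of_notMem_tsupport fun h => hx (hsub h)
  have hφ'0 : ∀ x, x ∉ Ioo a b → deriv φ x = 0 := fun x hx => by
    by_contra h
    exact hx (hsub (support_deriv_subset h))
  have hab : a ≤ b := by linarith
  rw [setIntegral_Ioi_eq_intervalIntegral ha hab fun x hx => by simp [hφ'0 x hx],
    setIntegral_Ioi_eq_intervalIntegral ha hab fun x hx => by simp [hφ0 x hx]]
  have hi : IntervalIntegrable v volume a b :=
    intervalIntegrable_of_locallyIntegrableOn_Ioi hv ha (by linarith)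
  have h1 : (1 : ℝ) ∈ uIcc a b := by rw [uIcc_of_le hab]; exact ⟨ha1.le, hb1.le⟩
  have hac := hi.absolutelyContinuousOnInterval_intervalIntegral h1
  have hφac : AbsolutelyContinuousOnInterval φ a b :=
    ContDiffOn.absolutelyContinuousOnInterval (hφ.of_le (by simp)).contDiffOn
  rw [hac.integral_mul_deriv_eq_deriv_mul hφac, hφ0 a (by simp), hφ0 b (by simp)]
  simp only [mul_zero, sub_zero, zero_sub]
  congr 1
  refine intervalIntegral.integral_congr_ae ?_
  filter_upwards [hi.ae_hasDerivAt_integral] with x hx hxm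
  rw [(hx (uIoc_subset_uIcc hxm) 1 h1).deriv]

theorem integrableOn_mul_of_hasCompactSupport {f φ : ℝ → ℝ} (hf : LocallyIntegrableOn f (Ioi 0))
    (hφ : Continuous φ) (hc : HasCompactSupport φ) (hs : tsupport φ ⊆ Ioi 0) :
    IntegrableOn (fun r => f r * φ r) (Ioi 0) := by
  have h2 : IntegrableOn (fun r => f r * φ r) (tsupport φ) :=
    (hf.integrableOn_compact_subset hs hc).mul_continuousOn hφ.continuousOn hc
  exact ((integrableOn_iff_integrable_of_support_subset (fun r hr => by
    apply subset_tsupport φ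
    intro h0
    exact hr (by simp [h0]))).1 h2).integrableOn

/-- A smooth function with compact support in `(0, ∞)` and vanishing integral is the derivative
of a smooth function with compact support in `(0, ∞)`. -/
theorem exists_deriv_eq_of_integral_eq_zero {ψ : ℝ → ℝ} (hψ : ContDiff ℝ ∞ ψ)
    (hc : HasCompactSupport ψ) (hs : tsupport ψ ⊆ Ioi 0) (h0 : ∫ r in Ioi (0 : ℝ), ψ r = 0) :
    ∃ φ : ℝ → ℝ, ContDiff ℝ ∞ φ ∧ HasCompactSupport φ ∧ tsupport φ ⊆ Ioi 0 ∧ deriv φ = ψ := by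
  obtain ⟨a, b, ha, ha1, hb1, hsub⟩ := exists_subset_Ioo_of_isCompact_subset_Ioi hc hs
  have hψ0 : ∀ x, x ∉ Ioo a b → ψ x = 0 := fun x hx =>
    image_eq_zero_of_notMem_tsupport fun h => hx (hsub h)
  have hd : ∀ x, HasDerivAt (fun r => ∫ t in a..r, ψ t) (ψ x) x := fun x =>
    hψ.continuous.integral_hasStrictDerivAt a x |>.hasDerivAt
  have hd' : deriv (fun r => ∫ t in a..r, ψ t) = ψ := funext fun x => (hd x).deriv
  have hsupp : Function.support (fun r => ∫ t in a..r, ψ t) ⊆ Icc a b := by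
    intro r hr
    by_contra hn
    apply hr
    rw [mem_Icc, not_and_or, not_le, not_le] at hn
    rcases hn with hn | hn
    · refine intervalIntegral.integral_zero_ae (Filter.Eventually.of_forall fun x hx => ?_)
      rw [uIoc_of_ge hn.le] at hx
      exact hψ0 x fun h => absurd h.1 (not_lt.2 hx.2)
    · change ∫ t in a..r, ψ t = 0
      rw [← setIntegral_Ioi_eq_intervalIntegral ha (by linarith) fun x hx => hψ0 x fun h =>
        hx ⟨h.1, h.2.trans hn⟩, h0]
  have hts : tsupport (fun r => ∫ t in a..r, ψ t) ⊆ Icc a b :=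
    closure_minimal hsupp isClosed_Icc
  refine ⟨fun r => ∫ t in a..r, ψ t, ?_, ?_, ?_, hd'⟩
  · rw [contDiff_infty_iff_deriv, hd']
    exact ⟨fun x => (hd x).differentiableAt, hψ⟩
  · exact HasCompactSupport.of_support_subset_isCompact isCompact_Icc hsupp
  · exact hts.trans fun x hx => ha.trans_le hx.1

/-- The lemma of du Bois-Reymond, in integrated form: a function with weak derivative `v` is
almost everywhere a primitive of `v`. -/
theorem IsWeakDeriv.exists_ae_eq_primitive {u v : ℝ → ℝ} (h : IsWeakDeriv u v) :
    ∃ c : ℝ, u =ᵐ[volume.restrict (Ioi 0)] fun r => c + ∫ t in (1 : ℝ)..r, v t := by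
  set w : ℝ → ℝ := fun r => ∫ t in (1 : ℝ)..r, v t with hw
  have hwv : IsWeakDeriv w v := isWeakDeriv_primitive h.2.1
  have hg : LocallyIntegrableOn (u - w) (Ioi 0) := h.1.sub hwv.1
  have hzero : ∀ φ : ℝ → ℝ, ContDiff ℝ ∞ φ → HasCompactSupport φ → tsupport φ ⊆ Ioi 0 →
      ∫ r in Ioi (0 : ℝ), (u - w) r * deriv φ r = 0 := by
    intro φ hφ hc hs
    have hdc : Continuous (deriv φ) := hφ.continuous_deriv (by simp)
    have hds : tsupport (deriv φ) ⊆ Ioi 0 := fun x hx => hs (tsupport_deriv_subset hx)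
    simp only [Pi.sub_apply, sub_mul]
    rw [integral_sub (integrableOn_mul_of_hasCompactSupport h.1 hdc hc.deriv hds)
      (integrableOn_mul_of_hasCompactSupport hwv.1 hdc hc.deriv hds),
      h.2.2 φ hφ hc hs, hwv.2.2 φ hφ hc hs, sub_self]
  let B : ContDiffBump (2 : ℝ) := ⟨1 / 2, 1, by norm_num, by norm_num⟩
  set η : ℝ → ℝ := B.normed volume with hη
  have hηd : ContDiff ℝ ∞ η := B.contDiff_normed
  have hηc : HasCompactSupport η := B.hasCompactSupport_normed
  have hηs : tsupport η ⊆ Ioi 0 := by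
    rw [hη, B.tsupport_normed_eq, Real.closedBall_eq_Icc]
    intro x hx
    have h1 : (2 : ℝ) - 1 ≤ x := hx.1
    exact lt_of_lt_of_le (by norm_num) h1
  have hfull : ∀ f : ℝ → ℝ, tsupport f ⊆ Ioi 0 → ∫ r in Ioi (0 : ℝ), f r = ∫ r, f r := by
    intro f hf
    refine setIntegral_eq_integral_of_forall_compl_eq_zero fun x hx => ?_
    exact image_eq_zero_of_notMem_tsupport fun h => hx (hf h)
  have hη1 : ∫ r in Ioi (0 : ℝ), η r = 1 := by rw [hfull η hηs]; exact B.integral_normed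
  set c := ∫ r in Ioi (0 : ℝ), (u - w) r * η r with hcdef
  refine ⟨c, ?_⟩
  have hcl : LocallyIntegrableOn (fun _ : ℝ => c) (Ioi 0) :=
    continuousOn_const.locallyIntegrableOn measurableSet_Ioi
  -- Testing `u - w` against `ψ - (∫ ψ) η`, which has integral zero and so is the derivative of a
  -- test function, shows that `u - w` and `c` agree as distributions.
  have key : ∀ᵐ x ∂(volume : Measure ℝ), x ∈ Ioi (0 : ℝ) → ((u - w) - fun _ => c : ℝ → ℝ) x = 0 := by
    refine isOpen_Ioi.ae_eq_zero_of_integral_contDiff_smul_eq_zero (hg.sub hcl) ?_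
    intro ψ hψ hψc hψs
    set I := ∫ r in Ioi (0 : ℝ), ψ r with hI
    have hψi : IntegrableOn ψ (Ioi 0) :=
      (hψ.continuous.integrable_of_hasCompactSupport hψc).integrableOn
    have hηi : IntegrableOn η (Ioi 0) :=
      (hηd.continuous.integrable_of_hasCompactSupport hηc).integrableOn
    have hIη : HasCompactSupport (fun r => I * η r) := hηc.mul_left
    have hIηs : tsupport (fun r => I * η r) ⊆ Ioi 0 :=
      (closure_mono (Function.support_mul_subset_right _ _)).trans hηs
    obtain ⟨φ, hφ, hφc, hφs, hφd⟩ := exists_deriv_eq_of_integral_eq_zero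
      (ψ := ψ - fun r => I * η r) (hψ.sub (contDiff_const.mul hηd)) (hψc.sub hIη)
      ((tsupport_sub _ _).trans (union_subset hψs hIηs)) (by
        simp only [Pi.sub_apply]
        rw [integral_sub hψi (hηi.const_mul I), integral_const_mul, hη1, mul_one, sub_self])
    have hz := hzero φ hφ hφc hφs
    rw [hφd] at hz
    have i1 := integrableOn_mul_of_hasCompactSupport hg hψ.continuous hψc hψs
    have i2 := integrableOn_mul_of_hasCompactSupport hg hηd.continuous hηc hηs
    have e1 : ∫ r in Ioi (0 : ℝ), (u - w) r * ψ r = I * c := by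
      have : ∀ r, (u - w) r * (ψ - fun r => I * η r) r
          = (u - w) r * ψ r - I * ((u - w) r * η r) := by
        intro r; simp only [Pi.sub_apply]; ring
      simp only [this] at hz
      rw [integral_sub i1 (i2.const_mul I), integral_const_mul] at hz
      linarith
    rw [← hfull _ ((tsupport_smul_subset_left _ _).trans hψs)]
    have : ∀ r, ψ r • (((u - w) - fun _ => c : ℝ → ℝ) r) = (u - w) r * ψ r - c * ψ r := by
      intro r; simp only [Pi.sub_apply, smul_eq_mul]; ring
    simp only [this]
    rw [integral_sub i1 (hψi.const_mul c), e1, integral_const_mul]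
    ring
  rw [Filter.EventuallyEq, ae_restrict_iff' measurableSet_Ioi]
  filter_upwards [key] with x hx h
  have := hx h
  simp only [Pi.sub_apply] at this
  change u x = c + w x
  linarith

/-! ### Weighted integrals -/

theorem ae_weighted_nonneg (p α : ℝ) (u : ℝ → ℝ) {s : Set ℝ} (hs : MeasurableSet s)
    (hs0 : s ⊆ Ioi 0) : 0 ≤ᵐ[volume.restrict s] fun r => |u r| ^ p * r ^ α := by
  refine (ae_restrict_iff' hs).2 (Filter.Eventually.of_forall fun r hr => ?_)
  have : (0 : ℝ) < r := hs0 hr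
  change 0 ≤ |u r| ^ p * r ^ α
  positivity

theorem integral_weighted_nonneg (p α : ℝ) (u : ℝ → ℝ) :
    0 ≤ ∫ r in Ioi (0 : ℝ), |u r| ^ p * r ^ α :=
  integral_nonneg_of_ae (ae_weighted_nonneg p α u measurableSet_Ioi Subset.rfl)

theorem setIntegral_weighted_mono {p α : ℝ} {u : ℝ → ℝ} {s t : Set ℝ} (ht : MeasurableSet t)
    (ht0 : t ⊆ Ioi 0) (hst : s ⊆ t) (hi : IntegrableOn (fun r => |u r| ^ p * r ^ α) (Ioi 0)) :
    ∫ r in s, |u r| ^ p * r ^ α ≤ ∫ r in t, |u r| ^ p * r ^ α :=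
  setIntegral_mono_set (hi.mono_set ht0) (ae_weighted_nonneg p α u ht ht0) (LE.le.eventuallyLE hst)

/-- Hölder's inequality for the weight `r ^ (p - 1)`, whose conjugate weight is `1 / r`: the
oscillation of a primitive of `v` over `(r, s)` is controlled by a power of `log (s / r)`. -/
theorem abs_intervalIntegral_le_log {p : ℝ} (hp : 1 < p) {v : ℝ → ℝ}
    (hv : AEStronglyMeasurable v (volume.restrict (Ioi 0))) {r s b : ℝ} (hr : 0 < r) (hrs : r ≤ s)
    (hi : IntegrableOn (fun t => |v t| ^ p * t ^ (p - 1)) (Ioi 0))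
    (hb : ∫ t in Ioc r s, |v t| ^ p * t ^ (p - 1) ≤ b) :
    |∫ t in r..s, v t| ≤ b ^ (1 / p) * Real.log (s / r) ^ ((p - 1) / p) := by
  have hp0 : 0 < p := by linarith
  have hsub : Ioc r s ⊆ Ioi 0 := fun t ht => hr.trans ht.1
  have hpq : p.HolderConjugate (p / (p - 1)) := Real.HolderConjugate.conjExponent hp
  have hq0 : 0 < p / (p - 1) := div_pos hp0 (by linarith)
  set f : ℝ → ℝ := fun t => |v t| * t ^ ((p - 1) / p) with hf
  set g : ℝ → ℝ := fun t => t ^ (-((p - 1) / p)) with hg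
  have hfp : ∀ t ∈ Ioc r s, f t ^ p = |v t| ^ p * t ^ (p - 1) := by
    intro t ht
    have ht0 : 0 < t := hsub ht
    rw [hf]
    simp only
    rw [Real.mul_rpow (abs_nonneg _) (by positivity), ← Real.rpow_mul ht0.le]
    congr 2; field_simp
  have hgq : ∀ t ∈ Ioc r s, g t ^ (p / (p - 1)) = t⁻¹ := by
    intro t ht
    have ht0 : 0 < t := hsub ht
    rw [hg]
    simp only
    rw [← Real.rpow_mul ht0.le, ← Real.rpow_neg_one]
    have : p - 1 ≠ 0 := by linarith
    congr 1; field_simp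
  have hvm : AEStronglyMeasurable v (volume.restrict (Ioc r s)) :=
    hv.mono_measure (Measure.restrict_mono hsub le_rfl)
  have hfm : AEStronglyMeasurable f (volume.restrict (Ioc r s)) :=
    (continuous_abs.comp_aestronglyMeasurable hvm).mul
      (Measurable.aestronglyMeasurable (by fun_prop))
  have hgm : AEStronglyMeasurable g (volume.restrict (Ioc r s)) :=
    Measurable.aestronglyMeasurable (by fun_prop)
  have hfn : ∀ t ∈ Ioc r s, 0 ≤ f t := fun t ht => by
    have ht0 : 0 < t := hsub ht
    positivity
  have hgn : ∀ t ∈ Ioc r s, 0 ≤ g t := fun t ht => by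
    have ht0 : 0 < t := hsub ht
    positivity
  have hae : ∀ {P : ℝ → Prop}, (∀ t ∈ Ioc r s, P t) → ∀ᵐ t ∂(volume.restrict (Ioc r s)), P t :=
    fun h => (ae_restrict_iff' measurableSet_Ioc).2 (Filter.Eventually.of_forall h)
  have hfL : MemLp f (ENNReal.ofReal p) (volume.restrict (Ioc r s)) := by
    rw [← integrable_norm_rpow_iff hfm (by simpa using hp0) (by simp),
      ENNReal.toReal_ofReal hp0.le]
    refine (hi.mono_set hsub).congr (hae fun t ht => ?_)
    simp only [Real.norm_of_nonneg (hfn t ht), hfp t ht]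
  have hinv : IntervalIntegrable (fun t : ℝ => t⁻¹) volume r s := by
    refine intervalIntegral.intervalIntegrable_inv (fun t ht => ?_) continuousOn_id
    rw [uIcc_of_le hrs] at ht
    exact (hr.trans_le ht.1).ne'
  have hgL : MemLp g (ENNReal.ofReal (p / (p - 1))) (volume.restrict (Ioc r s)) := by
    rw [← integrable_norm_rpow_iff hgm (by simpa using hq0) (by simp),
      ENNReal.toReal_ofReal hq0.le]
    refine ((intervalIntegrable_iff_integrableOn_Ioc_of_le hrs).1 hinv).congr (hae fun t ht => ?_)
    simp only [Real.norm_of_nonneg (hgn t ht), hgq t ht]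
  have hH := integral_mul_le_Lp_mul_Lq_of_nonneg hpq (hae hfn) (hae hgn) hfL hgL
  have e1 : ∫ t in Ioc r s, f t * g t = ∫ t in Ioc r s, |v t| := by
    refine setIntegral_congr_fun measurableSet_Ioc fun t ht => ?_
    have ht0 : 0 < t := hsub ht
    simp only [hf, hg]
    rw [mul_assoc, ← Real.rpow_add ht0, add_neg_cancel, Real.rpow_zero, mul_one]
  have e2 : ∫ t in Ioc r s, f t ^ p = ∫ t in Ioc r s, |v t| ^ p * t ^ (p - 1) :=
    setIntegral_congr_fun measurableSet_Ioc hfp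
  have e3 : ∫ t in Ioc r s, g t ^ (p / (p - 1)) = Real.log (s / r) := by
    rw [setIntegral_congr_fun measurableSet_Ioc hgq, ← intervalIntegral.integral_of_le hrs,
      integral_inv_of_pos hr (hr.trans_le hrs)]
  rw [e1, e2, e3, one_div_div] at hH
  have hn : 0 ≤ ∫ t in Ioc r s, |v t| ^ p * t ^ (p - 1) :=
    integral_nonneg_of_ae (ae_weighted_nonneg p (p - 1) v measurableSet_Ioc hsub)
  have hl : 0 ≤ Real.log (s / r) := Real.log_nonneg ((one_le_div hr).2 hrs)
  calc |∫ t in r..s, v t| ≤ ∫ t in r..s, |v t| := intervalIntegral.abs_integral_le_integral_abs hrs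
    _ = ∫ t in Ioc r s, |v t| := intervalIntegral.integral_of_le hrs
    _ ≤ _ := hH
    _ ≤ _ := by gcongr

/-! ### Subcritical estimates -/

/-- A primitive `w` of `v` is bounded on `[R, ∞)` by a constant depending only on bounds for its
weighted norms: by the logarithmic Hölder estimate it varies little over `[r, e r]`, so it cannot
be large at `r` without being large on this whole interval. -/
theorem exists_abs_le_of_weighted_bounds {p α₀ R A : ℝ} (hp : 1 < p) (hα₀ : -1 < α₀) (hR : 0 < R)
    (hA : 0 ≤ A) :
    ∃ M : ℝ, 0 ≤ M ∧ ∀ w v : ℝ → ℝ,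
      (∀ r s, 0 < r → r ≤ s → w s - w r = ∫ t in r..s, v t) →
      AEStronglyMeasurable v (volume.restrict (Ioi 0)) →
      IntegrableOn (fun r => |w r| ^ p * r ^ α₀) (Ioi 0) →
      IntegrableOn (fun r => |v r| ^ p * r ^ (p - 1)) (Ioi 0) →
      ∫ r in Ioi (0 : ℝ), |w r| ^ p * r ^ α₀ ≤ A →
      ∫ r in Ioi (0 : ℝ), |v r| ^ p * r ^ (p - 1) ≤ A →
      ∀ r, R ≤ r → |w r| ≤ M := by
  have hp0 : 0 < p := by linarith
  have hRp : 0 < R ^ (α₀ + 1) := by positivity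
  set K : ℝ := A / R ^ (α₀ + 1) + 1 with hK
  have hK0 : 0 < K := by positivity
  refine ⟨K ^ (1 / p) + A ^ (1 / p), by positivity, ?_⟩
  intro w v hwv hvm hwi hvi hwA hvA r hr
  have hr0 : 0 < r := hR.trans_le hr
  have he1 : (1 : ℝ) ≤ Real.exp 1 := Real.one_le_exp (by norm_num)
  have hre : r ≤ r * Real.exp 1 := le_mul_of_one_le_right hr0.le he1
  have hsub : Ioc r (r * Real.exp 1) ⊆ Ioi 0 := fun t ht => hr0.trans ht.1
  have hinv : IntervalIntegrable (fun t : ℝ => t⁻¹) volume r (r * Real.exp 1) := by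
    refine intervalIntegral.intervalIntegrable_inv (fun t ht => ?_) continuousOn_id
    rw [uIcc_of_le hre] at ht
    exact (hr0.trans_le ht.1).ne'
  have hinv1 : ∫ t in Ioc r (r * Real.exp 1), t⁻¹ = 1 := by
    rw [← intervalIntegral.integral_of_le hre, integral_inv_of_pos hr0 (hr0.trans_le hre),
      mul_div_cancel_left₀ _ hr0.ne', Real.log_exp]
  -- The weight `t ^ α₀` is at least `R ^ (α₀ + 1) / t`, and `1 / t` has integral `1` over `[r, e r]`;
  -- the summand `1` in `K` makes the contradiction strict.
  obtain ⟨s, hs, hsK⟩ : ∃ s ∈ Ioc r (r * Real.exp 1), |w s| ^ p ≤ K := by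
    by_contra! hcon
    have h1 : ∫ t in Ioc r (r * Real.exp 1), K * R ^ (α₀ + 1) * t⁻¹
        ≤ ∫ t in Ioc r (r * Real.exp 1), |w t| ^ p * t ^ α₀ := by
      refine setIntegral_mono_on
        (((intervalIntegrable_iff_integrableOn_Ioc_of_le hre).1 hinv).const_mul _)
        (hwi.mono_set hsub) measurableSet_Ioc fun t ht => ?_
      have ht0 : 0 < t := hsub ht
      have e : t ^ α₀ = t ^ (α₀ + 1) * t⁻¹ := by
        rw [Real.rpow_add_one ht0.ne', mul_assoc, mul_inv_cancel₀ ht0.ne', mul_one]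
      have hRt : R ^ (α₀ + 1) ≤ t ^ (α₀ + 1) :=
        Real.rpow_le_rpow hR.le (hr.trans ht.1.le) (by linarith)
      have := (hcon t ht).le
      rw [e, ← mul_assoc]
      gcongr
    have h2 : ∫ t in Ioc r (r * Real.exp 1), |w t| ^ p * t ^ α₀ ≤ A :=
      (setIntegral_weighted_mono measurableSet_Ioi Subset.rfl hsub hwi).trans hwA
    rw [integral_const_mul, hinv1, mul_one, hK, add_mul, div_mul_cancel₀ _ hRp.ne'] at h1
    linarith
  have hws : |w s| ≤ K ^ (1 / p) := by
    have := Real.rpow_le_rpow (by positivity) hsK (by positivity : 0 ≤ 1 / p)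
    rwa [← Real.rpow_mul (abs_nonneg _), mul_one_div_cancel hp0.ne', Real.rpow_one] at this
  have hb : ∫ t in Ioc r s, |v t| ^ p * t ^ (p - 1) ≤ A :=
    (setIntegral_weighted_mono measurableSet_Ioi Subset.rfl (fun t ht => hr0.trans ht.1)
      hvi).trans hvA
  have hH := abs_intervalIntegral_le_log hp hvm hr0 hs.1.le hvi hb
  have hlog0 : 0 ≤ Real.log (s / r) := Real.log_nonneg ((one_le_div hr0).2 hs.1.le)
  have hlog1 : Real.log (s / r) ≤ 1 := by
    rw [Real.log_le_iff_le_exp (div_pos (hr0.trans hs.1) hr0), div_le_iff₀ hr0]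
    linarith [hs.2]
  have hlogp : Real.log (s / r) ^ ((p - 1) / p) ≤ 1 :=
    Real.rpow_le_one hlog0 hlog1 (div_nonneg (by linarith) hp0.le)
  have hA1 : A ^ (1 / p) * Real.log (s / r) ^ ((p - 1) / p) ≤ A ^ (1 / p) :=
    mul_le_of_le_one_right (by positivity) hlogp
  rw [← hwv r s hr0 hs.1.le] at hH
  have := abs_sub_abs_le_abs_sub (w r) (w s)
  rw [abs_sub_comm] at this
  linarith

/-- Growth of `exp_p` along the logarithmic profile: the additive constant `M` and the factor
`t ^ (p - 1)` in the growth of `exp_p` are both absorbed by the strict inequality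
`μ b ^ (1 / (p - 1)) < κ`. -/
theorem exists_expP_le_exp {p μ b κ M : ℝ} (hp : 1 < p) (hμ : 0 ≤ μ) (hb : 0 ≤ b) (hM : 0 ≤ M)
    (h : μ * b ^ (1 / (p - 1)) < κ) :
    ∃ C : ℝ, ∀ l, 0 ≤ l →
      expP p (μ * (M + b ^ (1 / p) * l ^ ((p - 1) / p)) ^ (p / (p - 1)))
        ≤ C * Real.exp (κ * l) := by
  have hp0 : 0 < p := by linarith
  have hp1 : 0 < p - 1 := by linarith
  have hgp : 0 < Real.Gamma p := Real.Gamma_pos_of_pos hp0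
  obtain ⟨κ', hκ', hκ'κ⟩ := exists_between h
  have hκ'0 : 0 < κ' := lt_of_le_of_lt (by positivity) hκ'
  have hκ0 : 0 < κ := hκ'0.trans hκ'κ
  have ht1 : Filter.Tendsto
      (fun l : ℝ => μ * (M * l ^ (-((p - 1) / p)) + b ^ (1 / p)) ^ (p / (p - 1)))
      Filter.atTop (nhds (μ * (M * 0 + b ^ (1 / p)) ^ (p / (p - 1)))) := by
    refine Filter.Tendsto.const_mul _ (Filter.Tendsto.rpow_const ?_ (Or.inr (by positivity)))
    exact ((tendsto_rpow_neg_atTop (by positivity)).const_mul M).add_const _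
  have elim : μ * (M * 0 + b ^ (1 / p)) ^ (p / (p - 1)) = μ * b ^ (1 / (p - 1)) := by
    rw [mul_zero, zero_add, ← Real.rpow_mul hb]
    congr 2; field_simp
  rw [elim] at ht1
  have ht2 := (tendsto_exp_mul_div_rpow_atTop (p - 1) (κ - κ') (by linarith)).eventually_ge_atTop
    (κ' ^ (p - 1) / Real.Gamma p)
  obtain ⟨l₀, hl₀⟩ := Filter.eventually_atTop.1
    ((ht1.eventually_lt_const hκ').and (ht2.and (Filter.eventually_gt_atTop 0)))
  set F : ℝ → ℝ := fun l => μ * (M + b ^ (1 / p) * l ^ ((p - 1) / p)) ^ (p / (p - 1)) with hF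
  have hF0 : ∀ l, 0 ≤ l → 0 ≤ F l := fun l hl => by simp only [hF]; positivity
  have hlarge : ∀ l, l₀ ≤ l → expP p (F l) ≤ Real.exp (κ * l) := by
    intro l hl
    obtain ⟨h1, h2, h3⟩ := hl₀ l hl
    have hFl : F l ≤ κ' * l := by
      have hlp : 0 < l ^ ((p - 1) / p) := by positivity
      have e1 : M + b ^ (1 / p) * l ^ ((p - 1) / p)
          = (M * l ^ (-((p - 1) / p)) + b ^ (1 / p)) * l ^ ((p - 1) / p) := by
        rw [add_mul, mul_assoc, ← Real.rpow_add h3, neg_add_cancel, Real.rpow_zero, mul_one]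
      have e2 : (l ^ ((p - 1) / p)) ^ (p / (p - 1)) = l := by
        rw [← Real.rpow_mul h3.le, div_mul_div_cancel₀ hp0.ne', div_self hp1.ne', Real.rpow_one]
      simp only [hF]
      rw [e1, Real.mul_rpow (by positivity) hlp.le, e2, ← mul_assoc]
      gcongr
    refine (expP_le_expP hp (hF0 l h3.le) hFl).trans ((expP_le hp (by positivity)).trans ?_)
    rw [div_le_div_iff₀ hgp (by positivity)] at h2
    rw [Real.mul_rpow hκ'0.le h3.le, div_le_iff₀ hgp]
    have e3 : Real.exp (κ * l) = Real.exp ((κ - κ') * l) * Real.exp (κ' * l) := by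
      rw [← Real.exp_add]; ring_nf
    rw [e3]
    calc κ' ^ (p - 1) * l ^ (p - 1) * Real.exp (κ' * l)
        ≤ Real.exp ((κ - κ') * l) * Real.Gamma p * Real.exp (κ' * l) := by gcongr
      _ = _ := by ring
  set l₁ := max l₀ 0 with hl₁
  have hE0 : 0 ≤ expP p (F l₁) := expP_nonneg hp (hF0 _ (le_max_right _ _))
  refine ⟨1 + expP p (F l₁), fun l hl => ?_⟩
  have hexp : 1 ≤ Real.exp (κ * l) := Real.one_le_exp (by positivity)
  change expP p (F l) ≤ _
  rcases le_total l₁ l with hll | hll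
  · have := hlarge l ((le_max_left _ _).trans hll)
    nlinarith
  · have hmono : F l ≤ F l₁ := by
      simp only [hF]
      gcongr
    have := expP_le_expP hp (hF0 l hl) hmono
    nlinarith

/-- The uniform subcritical estimate: the exponential integral is bounded by a constant depending
only on bounds for the two weighted norms, provided the energy carried by `(0, R]` is subcritical.
-/
theorem exists_lintegral_expP_le {p α₀ θ μ R A b : ℝ} (hp : 1 < p) (hα₀ : -1 < α₀)
    (hθα : θ ≤ α₀) (hμ : 0 ≤ μ) (hR : 0 < R) (hA : 0 ≤ A) (hb : 0 ≤ b)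
    (h : μ * b ^ (1 / (p - 1)) < θ + 1) :
    ∃ C : ℝ≥0∞, C < ⊤ ∧ ∀ u v : ℝ → ℝ, IsWeakDeriv u v →
      MemWeightedLp p α₀ u → MemWeightedLp p (p - 1) v →
      ∫ r in Ioi (0 : ℝ), |u r| ^ p * r ^ α₀ ≤ A →
      ∫ r in Ioi (0 : ℝ), |v r| ^ p * r ^ (p - 1) ≤ A →
      ∫ r in Ioc (0 : ℝ) R, |v r| ^ p * r ^ (p - 1) ≤ b →
      ∫⁻ r in Ioi (0 : ℝ), ENNReal.ofReal (expP p (μ * |u r| ^ (p / (p - 1))) * r ^ θ) ≤ C := by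
  have hp0 : 0 < p := by linarith
  have hp1 : 0 < p - 1 := by linarith
  have hgp : 0 < Real.Gamma p := Real.Gamma_pos_of_pos hp0
  obtain ⟨M, hM, hsup⟩ := exists_abs_le_of_weighted_bounds hp hα₀ hR hA
  obtain ⟨κ, hκ, hκθ⟩ := exists_between h
  obtain ⟨C₁, hC₁⟩ := exists_expP_le_exp hp hμ hb hM hκ
  set T := μ * M ^ (p / (p - 1)) with hT
  set D := μ ^ (p - 1) * Real.exp T / Real.Gamma p * R ^ (θ - α₀) with hD
  have hD0 : 0 ≤ D := by positivity
  -- The first term bounds the integral over `(0, R]`, the second one that over `(R, ∞)`.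
  refine ⟨(∫⁻ r in Ioc 0 R, ENNReal.ofReal (C₁ * R ^ κ * r ^ (θ - κ))) + ENNReal.ofReal (D * A),
    ENNReal.add_lt_top.2 ⟨?_, ENNReal.ofReal_lt_top⟩, ?_⟩
  · have hi : IntegrableOn (fun r : ℝ => C₁ * R ^ κ * r ^ (θ - κ)) (Ioc 0 R) :=
      (((intervalIntegral.intervalIntegrable_rpow' (by linarith : -1 < θ - κ)).1).const_mul _)
    exact hi.lintegral_lt_top
  intro u v huv hu hv huA hvA hvb
  obtain ⟨c, hc⟩ := huv.exists_ae_eq_primitive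
  set w : ℝ → ℝ := fun r => c + ∫ t in (1 : ℝ)..r, v t with hw
  have hwv : ∀ r s, 0 < r → r ≤ s → w s - w r = ∫ t in r..s, v t := by
    intro r s hr hrs
    have i : ∀ x, 0 < x → IntervalIntegrable v volume 1 x := fun x hx =>
      intervalIntegrable_of_locallyIntegrableOn_Ioi huv.2.1 one_pos hx
    have := intervalIntegral.integral_interval_sub_left (i s (hr.trans_le hrs)) (i r hr)
    simp only [hw]
    linarith
  have hae : (fun r => |u r| ^ p * r ^ α₀) =ᵐ[volume.restrict (Ioi 0)]
      fun r => |w r| ^ p * r ^ α₀ := by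
    filter_upwards [hc] with r hr
    rw [hr]
  have hwi : IntegrableOn (fun r => |w r| ^ p * r ^ α₀) (Ioi 0) := hu.2.congr hae
  have hwA : ∫ r in Ioi (0 : ℝ), |w r| ^ p * r ^ α₀ ≤ A := by
    rw [← integral_congr_ae hae]; exact huA
  have hwM := hsup w v hwv hv.1 hwi hv.2 hwA hvA
  have hL : ∫⁻ r in Ioi (0 : ℝ), ENNReal.ofReal (expP p (μ * |u r| ^ (p / (p - 1))) * r ^ θ)
      = ∫⁻ r in Ioi (0 : ℝ), ENNReal.ofReal (expP p (μ * |w r| ^ (p / (p - 1))) * r ^ θ) := by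
    refine lintegral_congr_ae ?_
    filter_upwards [hc] with r hr
    rw [hr]
  rw [hL, ← Ioc_union_Ioi_eq_Ioi hR.le, lintegral_union measurableSet_Ioi
    (Ioc_disjoint_Ioi le_rfl)]
  refine add_le_add ?_ ?_
  · refine setLIntegral_mono' measurableSet_Ioc fun r hr => ENNReal.ofReal_le_ofReal ?_
    have hr0 : 0 < r := hr.1
    have hl0 : 0 ≤ Real.log (R / r) := Real.log_nonneg ((one_le_div hr0).2 hr.2)
    have hvb' : ∫ t in Ioc r R, |v t| ^ p * t ^ (p - 1) ≤ b :=
      (setIntegral_weighted_mono measurableSet_Ioc (fun t ht => ht.1)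
        (Ioc_subset_Ioc_left hr0.le) hv.2).trans hvb
    have hH := abs_intervalIntegral_le_log hp hv.1 hr0 hr.2 hv.2 hvb'
    rw [← hwv r R hr0 hr.2] at hH
    have hwr : |w r| ≤ M + b ^ (1 / p) * Real.log (R / r) ^ ((p - 1) / p) := by
      have h1 := abs_sub_abs_le_abs_sub (w r) (w R)
      rw [abs_sub_comm] at h1
      linarith [hwM R le_rfl]
    have hE := (expP_le_expP hp (by positivity)
      (show μ * |w r| ^ (p / (p - 1)) ≤ _ by gcongr)).trans (hC₁ _ hl0)
    have hexp : Real.exp (κ * Real.log (R / r)) = R ^ κ * r ^ (-κ) := by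
      rw [mul_comm, ← Real.rpow_def_of_pos (by positivity), Real.div_rpow hR.le hr0.le,
        Real.rpow_neg hr0.le]; rfl
    rw [hexp] at hE
    calc expP p (μ * |w r| ^ (p / (p - 1))) * r ^ θ
        ≤ C₁ * (R ^ κ * r ^ (-κ)) * r ^ θ := by gcongr
      _ = C₁ * R ^ κ * r ^ (θ - κ) := by
        rw [sub_eq_add_neg, add_comm θ, Real.rpow_add hr0]; ring
  · have hRi : IntegrableOn (fun r => D * (|w r| ^ p * r ^ α₀)) (Ioi 0) := hwi.const_mul D
    have hnn : 0 ≤ᵐ[volume.restrict (Ioi 0)] fun r => D * (|w r| ^ p * r ^ α₀) := by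
      filter_upwards [ae_weighted_nonneg p α₀ w measurableSet_Ioi Subset.rfl] with r hr
      exact mul_nonneg hD0 hr
    calc ∫⁻ r in Ioi R, ENNReal.ofReal (expP p (μ * |w r| ^ (p / (p - 1))) * r ^ θ)
        ≤ ∫⁻ r in Ioi R, ENNReal.ofReal (D * (|w r| ^ p * r ^ α₀)) := by
          refine setLIntegral_mono' measurableSet_Ioi fun r hr => ENNReal.ofReal_le_ofReal ?_
          have hRr : R < r := hr
          have hr0 : 0 < r := hR.trans hRr
          set t := μ * |w r| ^ (p / (p - 1)) with ht
          have ht0 : 0 ≤ t := by positivity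
          have htT : t ≤ T := by
            have := hwM r hRr.le
            simp only [ht, hT]
            gcongr
          have htp : t ^ (p - 1) = μ ^ (p - 1) * |w r| ^ p := by
            rw [ht, Real.mul_rpow hμ (by positivity), ← Real.rpow_mul (abs_nonneg _),
              div_mul_cancel₀ _ hp1.ne']
          have hrθ : r ^ θ ≤ R ^ (θ - α₀) * r ^ α₀ := by
            have h1 : r ^ (θ - α₀) ≤ R ^ (θ - α₀) :=
              Real.rpow_le_rpow_of_nonpos hR hRr.le (by linarith)
            calc r ^ θ = r ^ (θ - α₀) * r ^ α₀ := by rw [← Real.rpow_add hr0]; ring_nf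
              _ ≤ _ := by gcongr
          calc expP p t * r ^ θ
              ≤ (t ^ (p - 1) * Real.exp T / Real.Gamma p) * (R ^ (θ - α₀) * r ^ α₀) := by
                have h1 : expP p t ≤ t ^ (p - 1) * Real.exp T / Real.Gamma p :=
                  (expP_le hp ht0).trans (by gcongr)
                gcongr
            _ = _ := by rw [htp, hD]; ring
      _ ≤ ∫⁻ r in Ioi 0, ENNReal.ofReal (D * (|w r| ^ p * r ^ α₀)) :=
          lintegral_mono_set (Ioi_subset_Ioi hR.le)
      _ = ENNReal.ofReal (∫ r in Ioi 0, D * (|w r| ^ p * r ^ α₀)) :=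
          (ofReal_integral_eq_lintegral_ofReal hRi hnn).symm
      _ ≤ ENNReal.ofReal (D * A) := by
          rw [integral_const_mul]
          gcongr

theorem weightedLpNorm_rpow {p : ℝ} (hp : 1 < p) (α : ℝ) (u : ℝ → ℝ) :
    weightedLpNorm p α u ^ p = ∫ r in Ioi (0 : ℝ), |u r| ^ p * r ^ α := by
  rw [weightedLpNorm, ← Real.rpow_mul (integral_weighted_nonneg p α u),
    one_div_mul_cancel (by linarith), Real.rpow_one]

/-- The norm of the representative chosen by `weakDeriv` may be computed with any weak derivative. -/
theorem IsWeakDeriv.weightedLpNorm_weakDeriv {u v : ℝ → ℝ} (h : IsWeakDeriv u v) (p α : ℝ) :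
    weightedLpNorm p α (weakDeriv u) = weightedLpNorm p α v := by
  have hex : ∃ v, IsWeakDeriv u v := ⟨v, h⟩
  have hw : IsWeakDeriv u (weakDeriv u) := by
    rw [weakDeriv, dif_pos hex]; exact hex.choose_spec
  rw [weightedLpNorm, weightedLpNorm]
  congr 1
  refine integral_congr_ae ?_
  filter_upwards [hw.ae_eq h] with r hr
  rw [hr]

theorem IsWeakDeriv.weightedSobolevNorm_eq {u v : ℝ → ℝ} (h : IsWeakDeriv u v) {p : ℝ}
    (hp : 1 < p) (α₀ α₁ : ℝ) :
    weightedSobolevNorm p α₀ α₁ u = ((∫ r in Ioi (0 : ℝ), |u r| ^ p * r ^ α₀) +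
      ∫ r in Ioi (0 : ℝ), |v r| ^ p * r ^ α₁) ^ (1 / p) := by
  rw [weightedSobolevNorm, h.weightedLpNorm_weakDeriv, weightedLpNorm_rpow hp,
    weightedLpNorm_rpow hp]

theorem trudingerMoserSup_lt_top {p α₀ θ μ : ℝ} (hp : 1 < p) (hα₀ : -1 < α₀)
    (hθα : θ ≤ α₀) (hμ : 0 ≤ μ) (hμθ : μ < θ + 1) :
    trudingerMoserSup p α₀ μ θ < ⊤ := by
  obtain ⟨C, hC, hbound⟩ := exists_lintegral_expP_le (b := 1) (A := 1) (R := 1) hp hα₀ hθα hμ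
    one_pos zero_le_one zero_le_one (by simpa using hμθ)
  refine lt_of_le_of_lt (iSup₂_le fun u hu => ?_) hC
  obtain ⟨⟨hum, v, huv, hvm⟩, hnorm⟩ := hu
  rw [huv.weightedSobolevNorm_eq hp] at hnorm
  have h1 := integral_weighted_nonneg p α₀ u
  have h2 := integral_weighted_nonneg p (p - 1) v
  have hsum : (∫ r in Ioi (0 : ℝ), |u r| ^ p * r ^ α₀) +
      ∫ r in Ioi (0 : ℝ), |v r| ^ p * r ^ (p - 1) = 1 := by
    have h3 := congrArg (fun x : ℝ => x ^ p) hnorm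
    simpa only [← Real.rpow_mul (add_nonneg h1 h2), one_div_mul_cancel (by linarith : p ≠ 0),
      Real.rpow_one, Real.one_rpow] using h3
  refine hbound u v huv hum hvm (by linarith) (by linarith) ?_
  exact (setIntegral_weighted_mono measurableSet_Ioi Subset.rfl (fun t ht => ht.1) hvm.2).trans
    (by linarith)

theorem memWeightedLp_one_expP {p α₀ θ μ : ℝ} (hp : 1 < p) (hα₀ : -1 < α₀) (hθ : -1 < θ)
    (hθα : θ ≤ α₀) (hμ : 0 ≤ μ) {u : ℝ → ℝ} (hu : u ∈ weightedSobolev p α₀ (p - 1)) :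
    MemWeightedLp 1 θ (fun r => expP p (μ * |u r| ^ (p / (p - 1)))) := by
  obtain ⟨hum, v, huv, hvm⟩ := hu
  have hp1 : 0 < p - 1 := by linarith
  obtain ⟨b, hbθ, hb⟩ : ∃ b : ℝ, μ * b ^ (1 / (p - 1)) < θ + 1 ∧ 0 < b := by
    have ht : Filter.Tendsto (fun b : ℝ => μ * b ^ (1 / (p - 1))) (nhdsWithin 0 (Ioi 0))
        (nhds (μ * 0 ^ (1 / (p - 1)))) := by
      refine Filter.Tendsto.mono_left ?_ nhdsWithin_le_nhds
      exact ((Real.continuousAt_rpow_const _ _ (Or.inr (by positivity))).tendsto).const_mul μ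
    rw [Real.zero_rpow (by positivity), mul_zero] at ht
    exact ((ht.eventually_lt_const (by linarith : 0 < θ + 1)).and self_mem_nhdsWithin).exists
  -- Only the energy of `u` near the origin has to be small, not its full norm.
  obtain ⟨R, hR, hRb⟩ : ∃ R : ℝ, 0 < R ∧ ∫ r in Ioc (0 : ℝ) R, |v r| ^ p * r ^ (p - 1) ≤ b := by
    have hanti : Antitone fun n : ℕ => Ioc (0 : ℝ) (1 / (n + 1)) := fun m n hmn =>
      Ioc_subset_Ioc_right (Nat.one_div_le_one_div hmn)
    have ht := tendsto_setIntegral_of_antitone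
      (f := fun r => |v r| ^ p * r ^ (p - 1)) (fun n : ℕ => measurableSet_Ioc) hanti
      ⟨0, hvm.2.mono_set fun t ht => ht.1⟩
    have he : ⋂ n : ℕ, Ioc (0 : ℝ) (1 / (n + 1)) = ∅ := by
      refine eq_empty_iff_forall_notMem.2 fun x hx => ?_
      rw [mem_iInter] at hx
      obtain ⟨n, hn⟩ := exists_nat_one_div_lt (hx 0).1
      exact absurd (hx n).2 (not_le.2 hn)
    rw [he, setIntegral_empty] at ht
    obtain ⟨n, hn⟩ := (ht.eventually_lt_const hb).exists
    exact ⟨1 / (n + 1), by positivity, hn.le⟩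
  obtain ⟨C, hC, hbound⟩ := exists_lintegral_expP_le
    (A := max (∫ r in Ioi (0 : ℝ), |u r| ^ p * r ^ α₀)
      (∫ r in Ioi (0 : ℝ), |v r| ^ p * r ^ (p - 1)))
    hp hα₀ hθα hμ hR ((integral_weighted_nonneg p α₀ u).trans (le_max_left _ _)) hb.le hbθ
  have hlt := (hbound u v huv hum hvm (le_max_left _ _) (le_max_right _ _) hRb).trans_lt hC
  have hm : AEStronglyMeasurable (fun r => expP p (μ * |u r| ^ (p / (p - 1))))
      (volume.restrict (Ioi 0)) := by
    have hum' : AEMeasurable (fun r => μ * |u r| ^ (p / (p - 1))) (volume.restrict (Ioi 0)) := by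
      have := hum.1.aemeasurable
      fun_prop
    have := ((measurable_expP_max hp).comp_aemeasurable hum').aestronglyMeasurable
    refine this.congr (Filter.Eventually.of_forall fun r => ?_)
    simp only [Function.comp]
    rw [max_eq_left (by positivity)]
  refine ⟨hm, ?_⟩
  have hE : ∀ r, 0 ≤ expP p (μ * |u r| ^ (p / (p - 1))) := fun r => expP_nonneg hp (by positivity)
  simp only [Real.rpow_one, abs_of_nonneg (hE _)]
  refine ⟨hm.mul (Measurable.aestronglyMeasurable (by fun_prop)), ?_⟩
  rw [hasFiniteIntegral_iff_ofReal]
  · exact hlt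
  · refine (ae_restrict_iff' measurableSet_Ioi).2 (Filter.Eventually.of_forall fun t ht => ?_)
    have ht0 : (0 : ℝ) < t := ht
    exact mul_nonneg (hE t) (by positivity)

/-! ### Moser functions and divergence -/

theorem IsWeakDeriv.const_mul {u v : ℝ → ℝ} (h : IsWeakDeriv u v) (a : ℝ) :
    IsWeakDeriv (fun r => a * u r) (fun r => a * v r) := by
  refine ⟨h.1.smul a, h.2.1.smul a, fun φ hφ hc hs => ?_⟩
  simp only [mul_assoc, integral_const_mul]
  rw [h.2.2 φ hφ hc hs, mul_neg]

theorem abs_const_mul_rpow_mul (p α a x r : ℝ) :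
    |a * x| ^ p * r ^ α = |a| ^ p * (|x| ^ p * r ^ α) := by
  rw [abs_mul, Real.mul_rpow (abs_nonneg _) (abs_nonneg _), mul_assoc]

theorem MemWeightedLp.const_mul {p α : ℝ} {u : ℝ → ℝ} (h : MemWeightedLp p α u) (a : ℝ) :
    MemWeightedLp p α (fun r => a * u r) := by
  refine ⟨h.1.const_mul a, ?_⟩
  simp only [abs_const_mul_rpow_mul]
  exact h.2.const_mul _

/-- The derivative `-1 / r` on `(e⁻ᴸ, 1]`, and `0` elsewhere, of the Moser function
`r ↦ min L (log (1 / r))` cut off at `r = 1`. -/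
noncomputable def moserDeriv (L : ℝ) : ℝ → ℝ :=
  fun t => -(Ioc (Real.exp (-L)) 1).indicator (fun s => s⁻¹) t

/-- The Moser function, equal to `L` on `(0, e⁻ᴸ]`, to `log (1 / r)` on `[e⁻ᴸ, 1]` and to `0`
on `[1, ∞)`, written as a primitive of its derivative. -/
noncomputable def moser (L : ℝ) : ℝ → ℝ := fun r => ∫ t in (1 : ℝ)..r, moserDeriv L t

theorem integrable_indicator_inv {a : ℝ} (ha : 0 < a) :
    Integrable ((Ioc a 1).indicator fun s : ℝ => s⁻¹) := by
  refine IntegrableOn.integrable_indicator ?_ measurableSet_Ioc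
  refine IntegrableOn.mono_set (ContinuousOn.integrableOn_Icc ?_) Ioc_subset_Icc_self
  exact continuousOn_id.inv₀ fun x hx => (ha.trans_le hx.1).ne'

theorem integrable_moserDeriv (L : ℝ) : Integrable (moserDeriv L) :=
  (integrable_indicator_inv (Real.exp_pos _)).neg

theorem isWeakDeriv_moser (L : ℝ) : IsWeakDeriv (moser L) (moserDeriv L) :=
  isWeakDeriv_primitive ((integrable_moserDeriv L).locallyIntegrable.locallyIntegrableOn _)

theorem moser_of_one_le {L r : ℝ} (hr : 1 ≤ r) : moser L r = 0 := by
  refine intervalIntegral.integral_zero_ae (Filter.Eventually.of_forall fun t ht => ?_)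
  rw [uIoc_of_le hr] at ht
  rw [moserDeriv, indicator_of_notMem fun h => absurd h.2 (not_le.2 ht.1), neg_zero]

theorem moser_of_le_one {L r : ℝ} (hr : r ≤ 1) :
    moser L r = ∫ t in Ioc r 1, (Ioc (Real.exp (-L)) 1).indicator (fun s => s⁻¹) t := by
  rw [moser, intervalIntegral.integral_symm, intervalIntegral.integral_of_le hr]
  simp only [moserDeriv]
  rw [integral_neg, neg_neg]

theorem setIntegral_Ioc_inv {a : ℝ} (ha : 0 < a) (ha1 : a ≤ 1) :
    ∫ t in Ioc a 1, t⁻¹ = -Real.log a := by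
  rw [← intervalIntegral.integral_of_le ha1, integral_inv_of_pos ha one_pos, Real.log_div
    one_ne_zero ha.ne', Real.log_one, zero_sub]

theorem moser_eq {L r : ℝ} (hL : 0 ≤ L) (hr : r ≤ Real.exp (-L)) : moser L r = L := by
  have h1 : Real.exp (-L) ≤ 1 := Real.exp_le_one_iff.2 (by linarith)
  rw [moser_of_le_one (hr.trans h1), setIntegral_indicator measurableSet_Ioc,
    inter_eq_right.2 (Ioc_subset_Ioc_left hr), setIntegral_Ioc_inv (Real.exp_pos _) h1,
    Real.log_exp, neg_neg]

theorem moser_nonneg (L r : ℝ) : 0 ≤ moser L r := by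
  rcases le_total r 1 with h | h
  · rw [moser_of_le_one h]
    refine setIntegral_nonneg measurableSet_Ioc fun t ht => indicator_nonneg (fun s hs => ?_) t
    exact (inv_pos.2 ((Real.exp_pos _).trans hs.1)).le
  · rw [moser_of_one_le h]

theorem moser_le {L r : ℝ} (hr : 0 < r) (hr1 : r ≤ 1) : moser L r ≤ -Real.log r := by
  rw [moser_of_le_one hr1, ← setIntegral_Ioc_inv hr hr1]
  refine setIntegral_mono_on (integrable_indicator_inv (Real.exp_pos _)).integrableOn ?_
    measurableSet_Ioc fun t ht => ?_
  · exact (integrableOn_congr_fun (fun t ht => indicator_of_mem ht _) measurableSet_Ioc).1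
      (integrable_indicator_inv hr).integrableOn
  · exact indicator_le_self' (fun x hx => (inv_pos.2 (hr.trans ht.1)).le) t

theorem abs_moserDeriv_rpow_mul {p L r : ℝ} (hp : 1 < p) (hr : 0 < r) :
    |moserDeriv L r| ^ p * r ^ (p - 1) =
      (Ioc (Real.exp (-L)) 1).indicator (fun s => s⁻¹) r := by
  rw [moserDeriv, abs_neg]
  by_cases h : r ∈ Ioc (Real.exp (-L)) 1
  · rw [indicator_of_mem h, abs_of_pos (inv_pos.2 hr), Real.inv_rpow hr.le,
      Real.rpow_sub_one hr.ne']
    have : r ^ p ≠ 0 := (Real.rpow_pos_of_pos hr p).ne'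
    field_simp
  · rw [indicator_of_notMem h, abs_zero, Real.zero_rpow (by linarith), zero_mul]

theorem memWeightedLp_moserDeriv {p : ℝ} (hp : 1 < p) (L : ℝ) :
    MemWeightedLp p (p - 1) (moserDeriv L) := by
  refine ⟨(integrable_moserDeriv L).aestronglyMeasurable.restrict, ?_⟩
  exact (integrableOn_congr_fun (fun r hr => abs_moserDeriv_rpow_mul hp hr) measurableSet_Ioi).2
    (integrable_indicator_inv (Real.exp_pos _)).integrableOn

theorem integral_moserDeriv {p L : ℝ} (hp : 1 < p) (hL : 0 ≤ L) :
    ∫ r in Ioi (0 : ℝ), |moserDeriv L r| ^ p * r ^ (p - 1) = L := by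
  have h1 : Real.exp (-L) ≤ 1 := Real.exp_le_one_iff.2 (by linarith)
  rw [setIntegral_congr_fun measurableSet_Ioi fun r hr => abs_moserDeriv_rpow_mul hp hr,
    setIntegral_indicator measurableSet_Ioc,
    inter_eq_right.2 (show Ioc (Real.exp (-L)) 1 ⊆ Ioi 0 from fun t ht =>
      (Real.exp_pos (-L)).trans ht.1),
    setIntegral_Ioc_inv (Real.exp_pos _) h1, Real.log_exp, neg_neg]

/-- The Moser functions are dominated by `log (1 / r)` on `(0, 1)`, hence bounded in `L^p_{α₀}`. -/
theorem exists_integral_moser_le {p α₀ : ℝ} (hp : 1 < p) (hα₀ : -1 < α₀) :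
    ∃ K : ℝ, ∀ L, MemWeightedLp p α₀ (moser L) ∧
      ∫ r in Ioi (0 : ℝ), |moser L r| ^ p * r ^ α₀ ≤ K := by
  have hp0 : 0 < p := by linarith
  -- With `log (1 / r) ≤ r ^ (-ε) / ε`, this `ε` leaves the exponent `α₀ - ε p = (α₀ - 1) / 2 > -1`.
  set ε := (α₀ + 1) / (2 * p) with hε
  have hε0 : 0 < ε := div_pos (by linarith) (by linarith)
  set G : ℝ → ℝ := (Ioc (0 : ℝ) 1).indicator fun r => r ^ ((α₀ - 1) / 2) / ε ^ p with hG
  have hGi : Integrable G := by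
    refine IntegrableOn.integrable_indicator ?_ measurableSet_Ioc
    exact (intervalIntegral.intervalIntegrable_rpow' (by linarith)).1.div_const _
  have hle : ∀ L, ∀ r ∈ Ioi (0 : ℝ), |moser L r| ^ p * r ^ α₀ ≤ G r := by
    intro L r hr
    have hr0 : 0 < r := hr
    rcases le_or_gt r 1 with h | h
    · have hr1 : r ∈ Ioc (0 : ℝ) 1 := ⟨hr0, h⟩
      rw [hG, indicator_of_mem hr1, abs_of_nonneg (moser_nonneg L r)]
      have h1 : moser L r ≤ r ^ (-ε) / ε := by
        refine (moser_le hr0 h).trans ?_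
        have := Real.log_le_rpow_div (inv_pos.2 hr0).le hε0
        rwa [Real.log_inv, Real.inv_rpow hr0.le, ← Real.rpow_neg hr0.le] at this
      calc moser L r ^ p * r ^ α₀ ≤ (r ^ (-ε) / ε) ^ p * r ^ α₀ := by
            have := moser_nonneg L r
            gcongr
        _ = r ^ (-ε * p + α₀) / ε ^ p := by
            rw [Real.div_rpow (by positivity) hε0.le, ← Real.rpow_mul hr0.le,
              Real.rpow_add hr0]; ring
        _ = _ := by
            have : -ε * p + α₀ = (α₀ - 1) / 2 := by rw [hε]; field_simp; ring
            rw [this]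
    · rw [hG, indicator_of_notMem fun hm => absurd hm.2 (not_le.2 h), moser_of_one_le h.le,
        abs_zero, Real.zero_rpow hp0.ne', zero_mul]
  refine ⟨∫ r in Ioi (0 : ℝ), G r, fun L => ?_⟩
  have hm : AEStronglyMeasurable (moser L) (volume.restrict (Ioi 0)) :=
    (isWeakDeriv_moser L).1.aestronglyMeasurable
  have hi : IntegrableOn (fun r => |moser L r| ^ p * r ^ α₀) (Ioi 0) := by
    refine hGi.integrableOn.mono' ?_ ?_
    · have := hm.aemeasurable
      exact AEMeasurable.aestronglyMeasurable (by fun_prop)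
    · refine (ae_restrict_iff' measurableSet_Ioi).2 (Filter.Eventually.of_forall fun r hr => ?_)
      have hr0 : (0 : ℝ) < r := hr
      rw [Real.norm_of_nonneg (by positivity)]
      exact hle L r hr
  exact ⟨⟨hm, hi⟩, setIntegral_mono_on hi hGi.integrableOn measurableSet_Ioi (hle L)⟩

theorem setLIntegral_rpow_Ioc {θ a : ℝ} (hθ : -1 < θ) (ha : 0 ≤ a) :
    ∫⁻ r in Ioc 0 a, ENNReal.ofReal (r ^ θ) = ENNReal.ofReal (a ^ (θ + 1) / (θ + 1)) := by
  rw [← ofReal_integral_eq_lintegral_ofReal (intervalIntegral.intervalIntegrable_rpow' hθ).1,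
    ← intervalIntegral.integral_of_le ha, integral_rpow (Or.inl hθ),
    Real.zero_rpow (by linarith), sub_zero]
  refine (ae_restrict_iff' measurableSet_Ioc).2 (Filter.Eventually.of_forall fun r hr => ?_)
  have hr0 : (0 : ℝ) < r := hr.1
  change 0 ≤ r ^ θ
  positivity

/-- The lower bound for the supremum given by the normalised Moser functions, integrated over
`(0, e⁻ᴸ]`; `K` bounds the `p`-th powers of their `L^p_{α₀}` norms before normalisation. -/
theorem exists_le_trudingerMoserSup {p α₀ : ℝ} (hp : 1 < p) (hα₀ : -1 < α₀) :
    ∃ K : ℝ, 0 ≤ K ∧ ∀ θ μ L : ℝ, -1 < θ → 0 ≤ μ → 0 < L →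
      ENNReal.ofReal (expP p (μ * ((L / (K + L)) ^ (1 / (p - 1)) * L)) *
        (Real.exp (-L) ^ (θ + 1) / (θ + 1))) ≤ trudingerMoserSup p α₀ μ θ := by
  have hp0 : 0 < p := by linarith
  have hp1 : 0 < p - 1 := by linarith
  obtain ⟨K, hK⟩ := exists_integral_moser_le hp hα₀
  have hK0 : 0 ≤ K := (integral_weighted_nonneg p α₀ (moser 0)).trans (hK 0).2
  refine ⟨K, hK0, fun θ μ L hθ hμ hL => ?_⟩
  obtain ⟨hwm, hwK⟩ := hK L
  set J := ∫ r in Ioi (0 : ℝ), |moser L r| ^ p * r ^ α₀ with hJ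
  have hJ0 : 0 ≤ J := integral_weighted_nonneg p α₀ _
  set S := J + L with hS
  have hS0 : 0 < S := by positivity
  set a := (S ^ (1 / p))⁻¹ with ha
  have ha0 : 0 < a := by positivity
  have hap : |a| ^ p = S⁻¹ := by
    rw [abs_of_pos ha0, ha, Real.inv_rpow (by positivity), ← Real.rpow_mul hS0.le,
      one_div_mul_cancel hp0.ne', Real.rpow_one]
  have hwd := (isWeakDeriv_moser L).const_mul a
  have hmem : (fun r => a * moser L r) ∈ weightedSobolev p α₀ (p - 1) :=
    ⟨hwm.const_mul a, _, hwd, (memWeightedLp_moserDeriv hp L).const_mul a⟩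
  have hnorm : weightedSobolevNorm p α₀ (p - 1) (fun r => a * moser L r) = 1 := by
    rw [hwd.weightedSobolevNorm_eq hp]
    simp only [abs_const_mul_rpow_mul, integral_const_mul]
    rw [integral_moserDeriv hp hL.le, ← hJ, ← mul_add, ← hS, hap, inv_mul_cancel₀ hS0.ne',
      Real.one_rpow]
  refine le_trans ?_ (le_iSup₂ (f := fun (u : ℝ → ℝ) (_ : u ∈ {u : ℝ → ℝ |
    u ∈ weightedSobolev p α₀ (p - 1) ∧ weightedSobolevNorm p α₀ (p - 1) u = 1}) =>
    ∫⁻ r in Ioi (0 : ℝ), ENNReal.ofReal (expP p (μ * |u r| ^ (p / (p - 1))) * r ^ θ))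
    (fun r => a * moser L r) ⟨hmem, hnorm⟩)
  set E := expP p (μ * ((L / (K + L)) ^ (1 / (p - 1)) * L)) with hE
  have hE0 : 0 ≤ E := expP_nonneg hp (by positivity)
  rw [ENNReal.ofReal_mul hE0, ← setLIntegral_rpow_Ioc hθ (Real.exp_pos _).le,
    ← lintegral_const_mul' _ _ ENNReal.ofReal_ne_top]
  refine le_trans ?_ (lintegral_mono_set (s := Ioc 0 (Real.exp (-L))) fun t ht => ht.1)
  refine setLIntegral_mono' measurableSet_Ioc fun r hr => ?_
  have hr0 : 0 < r := hr.1
  rw [← ENNReal.ofReal_mul hE0]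
  refine ENNReal.ofReal_le_ofReal ?_
  have hval : |a * moser L r| ^ (p / (p - 1)) = (L / S) ^ (1 / (p - 1)) * L := by
    rw [moser_eq hL.le hr.2, abs_of_pos (by positivity), ha,
      Real.mul_rpow (by positivity) hL.le, Real.inv_rpow (by positivity), ← Real.rpow_mul hS0.le,
      Real.div_rpow hL.le hS0.le]
    have e1 : 1 / p * (p / (p - 1)) = 1 / (p - 1) := by field_simp
    have e2 : p / (p - 1) = 1 / (p - 1) + 1 := by field_simp; ring
    rw [e1, e2, Real.rpow_add_one hL.ne']
    ring
  rw [hval]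
  refine mul_le_mul_of_nonneg_right (expP_le_expP hp (by positivity) ?_) (by positivity)
  have hSK : S ≤ K + L := by linarith
  gcongr

theorem trudingerMoserSup_eq_top {p α₀ θ μ : ℝ} (hp : 1 < p) (hα₀ : -1 < α₀) (hθ : -1 < θ)
    (hμ : θ + 1 < μ) : trudingerMoserSup p α₀ μ θ = ⊤ := by
  have hp1 : 0 < p - 1 := by linarith
  have hθ1 : 0 < θ + 1 := by linarith
  obtain ⟨K, hK, hbound⟩ := exists_le_trudingerMoserSup hp hα₀
  obtain ⟨μ', hμ', hμ'μ⟩ := exists_between hμ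
  have hμ'0 : 0 < μ' := hθ1.trans hμ'
  have hratio : Filter.Tendsto (fun L : ℝ => L / (K + L)) Filter.atTop (nhds 1) := by
    have h1 : Filter.Tendsto (fun L : ℝ => 1 - K / (K + L)) Filter.atTop (nhds (1 - 0)) :=
      ((Filter.tendsto_atTop_add_const_left _ K Filter.tendsto_id).const_div_atTop K).const_sub 1
    rw [sub_zero] at h1
    refine h1.congr' ?_
    filter_upwards [Filter.eventually_gt_atTop 0] with L hL
    field_simp
    ring
  have hlim : Filter.Tendsto (fun L : ℝ => μ * (L / (K + L)) ^ (1 / (p - 1))) Filter.atTop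
      (nhds μ) := by
    have := (hratio.rpow_const (p := 1 / (p - 1)) (Or.inl one_ne_zero)).const_mul μ
    rwa [Real.one_rpow, mul_one] at this
  have hdiv : Filter.Tendsto (fun L : ℝ => expP p (μ' * L) *
      (Real.exp (-L) ^ (θ + 1) / (θ + 1))) Filter.atTop Filter.atTop := by
    have h1 := (tendsto_expP_mul_exp_neg (p := p) (κ := (θ + 1) / μ') hp (by positivity)
      ((div_lt_one hμ'0).2 hμ')).comp (Filter.tendsto_id.const_mul_atTop hμ'0)
    refine (h1.atTop_div_const hθ1).congr fun L => ?_
    have : -((θ + 1) / μ' * (μ' * L)) = -L * (θ + 1) := by field_simp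
    simp only [Function.comp, id, this, Real.exp_mul, mul_div_assoc]
  refine top_le_iff.1 (le_of_tendsto (ENNReal.tendsto_ofReal_atTop.comp hdiv) ?_)
  filter_upwards [hlim.eventually_const_lt hμ'μ, Filter.eventually_gt_atTop 0] with L hL hL0
  refine le_trans (ENNReal.ofReal_le_ofReal ?_) (hbound θ μ L hθ (by linarith) hL0)
  refine mul_le_mul_of_nonneg_right (expP_le_expP hp (by positivity) ?_) (by positivity)
  rw [← mul_assoc]
  exact mul_le_mul_of_nonneg_right hL.le hL0.le

theorem mainTheorem2 (p α₀ θ : ℝ) (hp : 1 < p) (hα₀ : -1 < α₀) (hθ : -1 < θ) :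
    (θ ≤ α₀ → ∀ μ : ℝ, 0 ≤ μ → ∀ u ∈ weightedSobolev p α₀ (p - 1),
      MemWeightedLp 1 θ (fun r => expP p (μ * |u r| ^ (p / (p - 1))))) ∧
    (θ ≤ α₀ → ∀ μ : ℝ, 0 ≤ μ → μ < θ + 1 → trudingerMoserSup p α₀ μ θ < ⊤) ∧
    (∀ μ : ℝ, θ + 1 < μ → trudingerMoserSup p α₀ μ θ = ⊤) :=
  ⟨fun hθα _ hμ _ hu => memWeightedLp_one_expP hp hα₀ hθ hθα hμ hu,
    fun hθα _ hμ hμθ => trudingerMoserSup_lt_top hp hα₀ hθα hμ hμθ,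
    fun _ hμ => trudingerMoserSup_eq_top hp hα₀ hθ hμ⟩
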